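/- For every $n\ge 1$ let $f_n:[0,1]^n\to\mathbb{R}$ be a twice differentiable function. Suppose that there are constants $a,b$ such that for every $n$ one has $|f_n|\le an$ on $[0,1]^n$ and all first-order partial derivatives of $f_n$ are bounded by $b$ in absolute value on $[0,1]^n$. For all $n$ and $1\le i,j\le n$ let $c_{n,i,j}$ be a real number such that $$\Bigl|\frac{\partial^2 f_n}{\partial x_i\partial x_j}(x)\Bigr|\le c_{n,i,j}\qquad\text{for all }x\in[0,1]^n .$$ For $\epsilon>0$ let $|\mathcal D_n(\epsilon)|$ be the smallest size of a finite set $D\subset\mathbb{R}^n$ such that for every $x\in[0,1]^n$ there is $z\in D$ with $\|\nabla f_n(x)-z\|<\epsilon\sqrt n$ (Euclidean norm), and define the complexity of the gradient of $f_n$ as $$C(f_n):=\inf_{\epsilon>0}\Bigl(\epsilon+\frac{\log|\mathcal D_n(\epsilon)|}{n}\Bigr).$$ Suppose that, as $n\to\infty$, $$C(f_n)=o(1),\qquad \sum_{i,j}c_{n,i,j}=o(n^2),\qquad \sum_{i,j}c_{n,i,j}^2=o(n),\qquad \sum_i c_{n,i,i}=o(n).$$ Let $p\in(0,1)$, let $I_p(u):=u\log\frac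 up+(1-u)\log\frac{1-u}{1-p}$ for $u\in[0,1]$ (with $0\log 0=0$), and for $t\in\mathbb{R}$ let $$\phi_{n,p}(t):=\frac1n\inf\Bigl\{\sum_{i=1}^n I_p(x_i)\;:\;x\in[0,1]^n,\ f_n(x)\ge tn\Bigr\}\in[0,\infty],$$ where $\inf\emptyset=\infty$. Assume that for every $t\in\mathbb{R}$ the limit $\phi_p(t):=\lim_{n\to\infty}\phi_{n,p}(t)$ exists in $[0,\infty]$. For each $n$ let $Y=(Y_1,\dots,Y_n)$ be a vector of i.i.d. random variables with $\mathbb{P}(Y_i=1)=p=1-\mathbb{P}(Y_i=0)$. Then for every $t\in\mathbb{R}$ at which $\phi_p$ is finite and continuous (as a $[0,\infty]$-valued function), $\mathbb{P}(f_n(Y)\ge tn)>0$ for all sufficiently large $n$, and $$\lim_{n\to\infty}\frac{\log\mathbb{P}(f_n(Y)\ge tn)}{n}=-\phi_p(t).$$ -/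

import Mathlib

open Filter Topology MeasureTheory ProbabilityTheory Asymptotics

namespace NonlinearLD

/-- The closed unit cube `[0,1]^n`. -/
def cube (n : ℕ) : Set (Fin n → ℝ) := Set.Icc 0 1

/-- The first-order partial derivative `∂f/∂x_i` of a function on the cube. It is taken within the
cube, so that it is one-sided on the faces and values of `f` outside the cube play no role. -/
noncomputable def pderiv {n : ℕ} (i : Fin n) (f : (Fin n → ℝ) → ℝ) (x : Fin n → ℝ) : ℝ :=
  fderivWithin ℝ f (cube n) x (Pi.single i 1)

/-- `f` is twice (Fréchet) differentiable on `[0,1]^n`; the second derivative need not be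
continuous. -/
def TwiceDifferentiableOnCube {n : ℕ} (f : (Fin n → ℝ) → ℝ) : Prop :=
  DifferentiableOn ℝ f (cube n) ∧
    DifferentiableOn ℝ (fderivWithin ℝ f (cube n)) (cube n)

/-- The finite set `D ⊆ ℝ^n` is an `ε√n`-net (in Euclidean distance) for the image of the cube
under the gradient of `f`. -/
def IsGradientNet {n : ℕ} (f : (Fin n → ℝ) → ℝ) (ε : ℝ) (D : Finset (Fin n → ℝ)) : Prop :=
  ∀ x ∈ cube n, ∃ z ∈ D, √(∑ i, (pderiv i f x - z i) ^ 2) < ε * √n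

/-- The complexity `C(f) = inf_{ε > 0} (ε + log |D(ε)| / n)` of the gradient of `f`, where `D(ε)` is
an `ε√n`-net for the image of the gradient of minimal size (the minimisation over nets is
merged into the infimum). Extended-real valued: it is `⊤` if there is no finite net. -/
noncomputable def gradientComplexity {n : ℕ} (f : (Fin n → ℝ) → ℝ) : EReal :=
  ⨅ (ε : ℝ) (_ : 0 < ε) (D : Finset (Fin n → ℝ)) (_ : IsGradientNet f ε D),
    ((ε + Real.log D.card / n : ℝ) : EReal)

/-- `I_p(u) = u log (u/p) + (1-u) log ((1-u)/(1-p))`, where `0 log 0 = 0`. -/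
noncomputable def entropy (p u : ℝ) : ℝ :=
  u * Real.log (u / p) + (1 - u) * Real.log ((1 - u) / (1 - p))

/-- The rate function `φ_{n,p}(t) = (1/n) inf {∑ i, I_p(x_i) : x ∈ [0,1]^n, f(x) ≥ tn}`, with value
`⊤` when there is no such `x`. -/
noncomputable def rate {n : ℕ} (f : (Fin n → ℝ) → ℝ) (p t : ℝ) : EReal :=
  ⨅ (x : Fin n → ℝ) (_ : x ∈ cube n) (_ : t * n ≤ f x),
    (((∑ i, entropy p (x i)) / n : ℝ) : EReal)

end NonlinearLD

/-! Lower bound: take `x` with `f x ≥ (t + δ) n` and nearly minimal entropy, and tilt the coin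
probabilities to `x`. Replacing coordinates by Bernoulli variables one at a time makes the
first-order terms martingale differences, so `f` deviates from `f x` by `o(n)` in mean square
(`sum_bern_mul_sq_le`). The tilted probability of the event tends to 1, and the entropy cost of
undoing the tilt bounds the original probability below (`neg_entropy_le_log_bern`).

Upper bound (`sum_bern_filter_le`): let `S` be the convex set of points with entropy below `R`,
where `f < (t - δ) n`. If `f ≥ t n` at a vertex `y`, the mean value theorem and the gradient net
give, for each `x ∈ S`, a net vector separating `y` from `x`. By minimax one convex combination of
net vectors serves all of `S` (`exists_weights`), and by Maurey a sum of `k` net vectors does too,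
with `k` independent of `n` (`exists_sum_close`). So at most `|D| ^ k` events cover the event. The
barycentre of each nonempty one lies outside `S`, so each has probability at most `exp (-R)`
(`exists_barycentre`); since `log |D| = o(n)`, the count is negligible. -/

namespace NonlinearLD

/-! ### Product Bernoulli measures on the discrete cube. -/

variable {n : ℕ}

/-- The point mass at `y ∈ {0,1}^n` of the product of the Bernoulli distributions with
success probabilities `x i`. -/
noncomputable def bern (x : Fin n → ℝ) (y : Fin n → Bool) : ℝ :=
  ∏ i, cond (y i) (x i) (1 - x i)

/-- The vertex of the cube encoded by a Boolean vector. -/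
def vertex (y : Fin n → Bool) : Fin n → ℝ := fun i => cond (y i) 1 0

lemma mem_cube {x : Fin n → ℝ} : x ∈ cube n ↔ ∀ i, 0 ≤ x i ∧ x i ≤ 1 := by
  simp [cube, Set.mem_Icc, Pi.le_def, forall_and]

lemma convex_cube : Convex ℝ (cube n) := convex_Icc 0 1

lemma vertex_mem_cube (y : Fin n → Bool) : vertex y ∈ cube n :=
  mem_cube.2 fun i => by cases h : y i <;> simp [vertex, h]

lemma bern_nonneg {x : Fin n → ℝ} (hx : x ∈ cube n) (y : Fin n → Bool) : 0 ≤ bern x y :=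
  Finset.prod_nonneg fun i _ => by
    have := mem_cube.1 hx i
    cases y i <;> simp [this.1, this.2]

lemma sum_bern (x : Fin n → ℝ) : ∑ y, bern x y = 1 := by
  have h := Finset.prod_univ_sum (fun _ : Fin n => (Finset.univ : Finset Bool))
    (fun i c => cond c (x i) (1 - x i))
  rw [Fintype.piFinset_univ] at h
  unfold bern
  rw [← h]
  simp

/-- Integrating out the `k`-th coordinate. -/
lemma sum_bern_mul (x : Fin n → ℝ) (k : Fin n) (F : (Fin n → Bool) → ℝ) :
    ∑ y, bern x y * F y = ∑ y, bern x y *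
      (x k * F (Function.update y k true) + (1 - x k) * F (Function.update y k false)) := by
  let e : (Fin n → Bool) → (Fin n → Bool) := fun y => Function.update y k (!y k)
  have he : Function.Involutive e := fun y => by
    ext i; by_cases h : i = k
    · subst h; simp [e]
    · simp [e, h]
  let r : (Fin n → Bool) → ℝ := fun y => ∏ i ∈ Finset.univ.erase k, cond (y i) (x i) (1 - x i)
  have hr : ∀ y, bern x y = cond (y k) (x k) (1 - x k) * r y := fun y =>
    (Finset.mul_prod_erase _ _ (Finset.mem_univ k)).symm
  have hre : ∀ y, r (e y) = r y := fun y =>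
    Finset.prod_congr rfl fun i hi => by simp [e, Finset.ne_of_mem_erase hi]
  have hflip : ∀ G : (Fin n → Bool) → ℝ, ∑ y, G (e y) = ∑ y, G y := fun G =>
    Equiv.sum_comp he.toPerm G
  set G : (Fin n → Bool) → ℝ := fun y =>
    x k * F (Function.update y k true) + (1 - x k) * F (Function.update y k false) with hG
  -- Pair `y` with its flip at `k`. `G` is constant on each pair, and summing over all `y` counts
  -- every pair twice.
  have key : ∀ y, bern x y * F y + bern x (e y) * F (e y) =
      bern x y * G y + bern x (e y) * G (e y) := by
    intro y
    have hGe : G (e y) = G y := by simp [hG, e]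
    have hek : e y k = !y k := by simp [e]
    rw [hGe, hr, hr, hre, hek]
    cases hy : y k
    · have h1 : F y = F (Function.update y k false) := by rw [← hy, Function.update_eq_self]
      have h2 : F (e y) = F (Function.update y k true) := by simp [e, hy]
      rw [h1, h2, hG]; simp; ring
    · have h1 : F y = F (Function.update y k true) := by rw [← hy, Function.update_eq_self]
      have h2 : F (e y) = F (Function.update y k false) := by simp [e, hy]
      rw [h1, h2, hG]; simp; ring
  have h := Finset.sum_congr rfl fun y (_ : y ∈ Finset.univ) => key y
  rw [Finset.sum_add_distrib, Finset.sum_add_distrib, hflip fun y => bern x y * F y,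
    hflip fun y => bern x y * G y] at h
  linarith

lemma sum_bern_mul_vertex (x : Fin n → ℝ) (i : Fin n) :
    ∑ y, bern x y * vertex y i = x i := by
  rw [sum_bern_mul x i]
  simp [vertex, ← Finset.sum_mul, sum_bern]

/-! ### Relative entropy bounds. -/

/-- The Gibbs variational inequality on a finite set. -/
lemma gibbs {α : Type*} [Fintype α] {ν u h : α → ℝ} {C : ℝ} (hν : ∀ y, 0 ≤ ν y)
    (hν1 : ∑ y, ν y = 1) (hu : ∀ y, ν y * Real.exp (h y) ≤ u y) (hC : 0 < C)
    (huC : ∑ y, u y ≤ C) : ∑ y, ν y * h y ≤ Real.log C := by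
  -- Jensen in linearised form: `1 + s ≤ exp s` at `s = h y - log C`, weighted by `ν y`.
  have h1 : ∀ y, ν y * (h y - Real.log C) ≤ u y / C - ν y := by
    intro y
    have h2 := Real.add_one_le_exp (h y - Real.log C)
    rw [Real.exp_sub, Real.exp_log hC] at h2
    have h3 := mul_le_mul_of_nonneg_left h2 (hν y)
    have h4 : ν y * (Real.exp (h y) / C) ≤ u y / C := by
      rw [← mul_div_assoc]; exact div_le_div_of_nonneg_right (hu y) hC.le
    linarith
  have h2 := Finset.sum_le_sum fun y (_ : y ∈ Finset.univ) => h1 y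
  simp only [mul_sub, Finset.sum_sub_distrib, ← Finset.sum_mul, ← Finset.sum_div, hν1] at h2
  have h3 : (∑ y, u y) / C ≤ 1 := (div_le_one hC).2 huC
  linarith

/-- The logarithm of the likelihood ratio of `bern x` with respect to `bern (fun _ => p)`. -/
noncomputable def llr (p : ℝ) (x : Fin n → ℝ) (y : Fin n → Bool) : ℝ :=
  ∑ i, cond (y i) (Real.log (x i / p)) (Real.log ((1 - x i) / (1 - p)))

/-- `llr` is affine in the vertex, so only the marginals of `ν` matter. This serves both product
measures and conditioned ones. -/
lemma sum_mul_llr {p : ℝ} {x : Fin n → ℝ} {ν : (Fin n → Bool) → ℝ} (hν : ∑ y, ν y = 1)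
    (hx : ∀ i, ∑ y, ν y * vertex y i = x i) :
    ∑ y, ν y * llr p x y = ∑ i, entropy p (x i) := by
  unfold llr
  simp_rw [Finset.mul_sum]
  rw [Finset.sum_comm]
  refine Finset.sum_congr rfl fun i _ => ?_
  have h : ∀ y : Fin n → Bool,
      ν y * cond (y i) (Real.log (x i / p)) (Real.log ((1 - x i) / (1 - p))) =
      (ν y * vertex y i) * Real.log (x i / p) +
        (ν y - ν y * vertex y i) * Real.log ((1 - x i) / (1 - p)) := by
    intro y; cases hy : y i <;> simp [vertex, hy]
  simp_rw [h]
  rw [Finset.sum_add_distrib, ← Finset.sum_mul, ← Finset.sum_mul, Finset.sum_sub_distrib, hx, hν]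
  rfl

/-- The side conditions exclude the factors where `log 0 = 0` would give the wrong ratio; `bern x y`
vanishes at the excluded vertices. -/
lemma bern_mul_exp_llr {p : ℝ} (hp : p ∈ Set.Ioo (0 : ℝ) 1) {x : Fin n → ℝ} (hx : x ∈ cube n)
    {y : Fin n → Bool} (h1 : ∀ i, y i = true → x i ≠ 0) (h0 : ∀ i, y i = false → x i ≠ 1) :
    bern (fun _ => p) y * Real.exp (llr p x y) = bern x y := by
  unfold bern llr
  rw [Real.exp_sum, ← Finset.prod_mul_distrib]
  refine Finset.prod_congr rfl fun i _ => ?_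
  have hxi := mem_cube.1 hx i
  have hp' : 0 < 1 - p := by linarith [hp.2]
  cases hy : y i
  · have : 0 < 1 - x i := lt_of_le_of_ne (by linarith) (fun h => h0 i hy (by linarith))
    simp only [cond_false]
    rw [Real.exp_log (div_pos this hp')]
    field_simp
  · have : 0 < x i := lt_of_le_of_ne hxi.1 (Ne.symm (h1 i hy))
    simp only [cond_true]
    rw [Real.exp_log (div_pos this hp.1)]
    have := hp.1.ne'
    field_simp

lemma bern_const_pos {p : ℝ} (hp : p ∈ Set.Ioo (0 : ℝ) 1) (y : Fin n → Bool) :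
    0 < bern (fun _ => p) y :=
  Finset.prod_pos fun i _ => by cases y i <;> simp [hp.1, hp.2]

/-- Lower bound for the `p`-biased probability of an event in terms of its probability
under a tilted product measure. -/
lemma neg_entropy_le_log_bern {p : ℝ} (hp : p ∈ Set.Ioo (0 : ℝ) 1) {x : Fin n → ℝ}
    (hx : x ∈ cube n) {A : Finset (Fin n → Bool)} (hA : A.Nonempty) :
    -(∑ i, entropy p (x i)) - Real.log 2 ≤
      (∑ y ∈ A, bern x y) * Real.log (∑ y ∈ A, bern (fun _ => p) y) := by
  classical
  set q := ∑ y ∈ A, bern (fun _ => p) y with hq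
  have hqpos : 0 < q := Finset.sum_pos (fun y _ => bern_const_pos hp y) hA
  -- Under the `p`-biased law `exp g` has mean at most `q / q + 1 = 2`, whence the `log 2`.
  let g : (Fin n → Bool) → ℝ := fun y => if y ∈ A then -Real.log q else 0
  have h := gibbs (ν := bern x) (h := fun y => g y - llr p x y)
    (u := fun y => bern (fun _ => p) y * Real.exp (g y)) (C := 2) (bern_nonneg hx) (sum_bern x)
    ?_ two_pos ?_
  · have h1 : ∑ y, bern x y * g y = -((∑ y ∈ A, bern x y) * Real.log q) := by
      simp [g, ← Finset.sum_mul]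
    simp only [mul_sub, Finset.sum_sub_distrib] at h
    rw [h1, sum_mul_llr (sum_bern x) (sum_bern_mul_vertex x)] at h
    linarith
  · intro y
    by_cases hy : (∀ i, y i = true → x i ≠ 0) ∧ ∀ i, y i = false → x i ≠ 1
    · rw [← bern_mul_exp_llr hp hx hy.1 hy.2, mul_assoc, ← Real.exp_add]
      simp
    · have : bern x y = 0 := by
        unfold bern
        rw [not_and_or] at hy
        push Not at hy
        rcases hy with ⟨i, h1, h2⟩ | ⟨i, h1, h2⟩ <;>
        exact Finset.prod_eq_zero (Finset.mem_univ i) (by simp [h1, h2])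
      rw [this, zero_mul]
      exact mul_nonneg (bern_const_pos hp y).le (Real.exp_pos _).le
  · have h1 : ∀ y, bern (fun _ => p) y * Real.exp (g y) ≤
        (if y ∈ A then bern (fun _ => p) y * q⁻¹ else 0) + bern (fun _ => p) y := by
      intro y
      have := (bern_const_pos hp y).le
      by_cases hy : y ∈ A <;> simp [g, hy, Real.exp_neg, Real.exp_log hqpos, this]
    refine (Finset.sum_le_sum fun y _ => h1 y).trans ?_
    rw [Finset.sum_add_distrib, sum_bern, Finset.sum_ite_mem, Finset.univ_inter,
      ← Finset.sum_mul, ← hq, mul_inv_cancel₀ hqpos.ne']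
    norm_num

/-- The `p`-biased probability of an event is at most `exp (-∑ I_p)` at the barycentre of the
event. -/
lemma exists_barycentre {p : ℝ} (hp : p ∈ Set.Ioo (0 : ℝ) 1) {B : Finset (Fin n → Bool)}
    (hB : B.Nonempty) : ∃ x ∈ cube n,
      ∑ y ∈ B, bern (fun _ => p) y ≤ Real.exp (-∑ i, entropy p (x i)) ∧
      ∀ z : Fin n → ℝ, ∃ y ∈ B, ∑ i, z i * vertex y i ≤ ∑ i, z i * x i := by
  classical
  set q := ∑ y ∈ B, bern (fun _ => p) y with hq
  have hqpos : 0 < q := Finset.sum_pos (fun y _ => bern_const_pos hp y) hB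
  let ν : (Fin n → Bool) → ℝ := fun y => if y ∈ B then bern (fun _ => p) y / q else 0
  have hν0 : ∀ y, 0 ≤ ν y := fun y => by
    by_cases hy : y ∈ B <;> simp [ν, hy, div_nonneg (bern_const_pos hp y).le hqpos.le]
  have hν1 : ∑ y, ν y = 1 := by
    simp only [ν]
    rw [Finset.sum_ite_mem, Finset.univ_inter, ← Finset.sum_div, ← hq, div_self hqpos.ne']
  let x : Fin n → ℝ := fun i => ∑ y, ν y * vertex y i
  have hvert : ∀ (y : Fin n → Bool) i, 0 ≤ vertex y i ∧ vertex y i ≤ 1 := fun y i =>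
    mem_cube.1 (vertex_mem_cube y) i
  have hx : x ∈ cube n := mem_cube.2 fun i =>
    ⟨Finset.sum_nonneg fun y _ => mul_nonneg (hν0 y) (hvert y i).1, by
      rw [← hν1]
      exact Finset.sum_le_sum fun y _ => mul_le_of_le_one_right (hν0 y) (hvert y i).2⟩
  have hνpos : ∀ y ∈ B, 0 < ν y := fun y hy => by
    simp only [ν, hy, if_true]; exact div_pos (bern_const_pos hp y) hqpos
  refine ⟨x, hx, ?_, ?_⟩
  -- `ν` is the law conditioned on `B`, with mean `x`. On `B`, `ν * exp llr = bern x / q`, so Gibbs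
  -- gives `∑ I_p ≤ -log q`.
  · have h := gibbs (ν := ν) (h := llr p x) (u := fun y => bern x y / q) (C := q⁻¹) hν0 hν1 ?_
      (inv_pos.2 hqpos) (by rw [← Finset.sum_div, sum_bern, one_div])
    · rw [sum_mul_llr hν1 (fun i => rfl), Real.log_inv] at h
      rw [← Real.log_le_iff_le_exp hqpos]
      linarith
    · intro y
      by_cases hy : y ∈ B
      · have hνy : ν y = bern (fun _ => p) y / q := by simp [ν, hy]
        rw [hνy, div_mul_eq_mul_div, bern_mul_exp_llr hp hx]
        -- A vertex of positive mass forces `x i > 0` where `y i` is true, and `x i < 1` where it is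
        -- false.
        · intro i hi h0
          have h1 : ν y * vertex y i ≤ x i := Finset.single_le_sum
            (f := fun y => ν y * vertex y i)
            (fun y _ => mul_nonneg (hν0 y) (hvert y i).1) (Finset.mem_univ y)
          have := hνpos y hy
          simp [vertex, hi] at h1
          linarith
        · intro i hi h0
          have h1 : ν y * (1 - vertex y i) ≤ ∑ y, ν y * (1 - vertex y i) := Finset.single_le_sum
            (f := fun y => ν y * (1 - vertex y i))
            (fun y _ => mul_nonneg (hν0 y) (by linarith [(hvert y i).2])) (Finset.mem_univ y)
          have := hνpos y hy
          have h2 : ∑ y, ν y * (1 - vertex y i) = 1 - x i := by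
            simp only [mul_sub, Finset.sum_sub_distrib, mul_one, hν1, x]
          rw [h2, h0] at h1
          simp [vertex, hi] at h1
          linarith
      · simp [ν, hy, div_nonneg (bern_nonneg hx y) hqpos.le]
  · intro z
    by_contra! hcon
    have h1 : ∑ i, z i * x i = ∑ y, ν y * ∑ i, z i * vertex y i := by
      simp only [x, Finset.mul_sum]
      rw [Finset.sum_comm]
      exact Finset.sum_congr rfl fun y _ => Finset.sum_congr rfl fun i _ => by ring
    obtain ⟨y₀, hy₀⟩ := hB
    have h2 : ∑ y, ν y * ∑ i, z i * x i < ∑ y, ν y * ∑ i, z i * vertex y i := by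
      refine Finset.sum_lt_sum (fun y _ => ?_) ⟨y₀, Finset.mem_univ _,
        mul_lt_mul_of_pos_left (hcon y₀ hy₀) (hνpos y₀ hy₀)⟩
      by_cases hy : y ∈ B
      · exact mul_le_mul_of_nonneg_left (hcon y hy).le (hν0 y)
      · simp [ν, hy]
    rw [← Finset.sum_mul, hν1, one_mul, ← h1] at h2
    exact lt_irrefl _ h2

/-! ### Convexity and positivity of the entropy. -/

/-- Negative binary entropy plus an affine function, which reduces convexity to
`Real.strictConcave_binEntropy`. -/
lemma entropy_eq {p u : ℝ} (hp : p ∈ Set.Ioo (0 : ℝ) 1) :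
    entropy p u = u * Real.log u + (1 - u) * Real.log (1 - u) +
      (-(Real.log p) * u + -(Real.log (1 - p)) * (1 - u)) := by
  have h1 : u * Real.log (u / p) = u * Real.log u - u * Real.log p := by
    rcases eq_or_ne u 0 with rfl | h
    · simp
    · rw [Real.log_div h hp.1.ne']; ring
  have h2 : (1 - u) * Real.log ((1 - u) / (1 - p)) =
      (1 - u) * Real.log (1 - u) - (1 - u) * Real.log (1 - p) := by
    rcases eq_or_ne (1 - u) 0 with h | h
    · simp [h]
    · rw [Real.log_div h (by linarith [hp.2])]; ring
  rw [entropy, h1, h2]; ring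

lemma convexOn_entropy {p : ℝ} (hp : p ∈ Set.Ioo (0 : ℝ) 1) :
    ConvexOn ℝ (Set.Icc (0 : ℝ) 1) (entropy p) := by
  have h := Real.strictConcave_binEntropy.concaveOn.neg
  refine ⟨convex_Icc 0 1, fun x hx y hy s r hs hr hsr => ?_⟩
  have h1 := h.2 hx hy hs hr hsr
  rw [entropy_eq hp, entropy_eq hp, entropy_eq hp]
  simp only [Pi.neg_apply, Real.binEntropy_eq_negMulLog_add_negMulLog_one_sub, Real.negMulLog,
    smul_eq_mul] at h1 ⊢
  obtain rfl : r = 1 - s := by linarith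
  linarith

lemma entropy_nonneg {p u : ℝ} (hp : p ∈ Set.Ioo (0 : ℝ) 1) (hu : u ∈ Set.Icc (0 : ℝ) 1) :
    0 ≤ entropy p u := by
  have key : ∀ {v q : ℝ}, 0 ≤ v → 0 < q → v - q ≤ v * Real.log (v / q) := by
    intro v q hv hq
    rcases hv.eq_or_lt with rfl | hv
    · simpa using hq.le
    · have := mul_le_mul_of_nonneg_left (Real.one_sub_inv_le_log_of_pos (div_pos hv hq)) hv.le
      refine le_trans (le_of_eq ?_) this
      field_simp
  have h1 := key hu.1 hp.1
  have h2 := key (v := 1 - u) (q := 1 - p) (by linarith [hu.2]) (by linarith [hp.2])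
  unfold entropy
  linarith

lemma convex_entropy_lt {p : ℝ} (hp : p ∈ Set.Ioo (0 : ℝ) 1) (R : ℝ) :
    Convex ℝ {x | x ∈ cube n ∧ ∑ i, entropy p (x i) < R} := by
  have h : ConvexOn ℝ (cube n) fun x => ∑ i, entropy p (x i) := by
    refine ⟨convex_cube, fun x hx y hy s r hs hr hsr => ?_⟩
    simp only [smul_eq_mul, Finset.mul_sum]
    rw [← Finset.sum_add_distrib]
    exact Finset.sum_le_sum fun i _ =>
      (convexOn_entropy hp).2 (mem_cube.1 hx i) (mem_cube.1 hy i) hs hr hsr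
  exact h.convex_lt R

/-! ### Mean value estimates on the cube. -/

lemma fderivWithin_cube_apply (f : (Fin n → ℝ) → ℝ) (x v : Fin n → ℝ) :
    fderivWithin ℝ f (cube n) x v = ∑ i, pderiv i f x * v i := by
  conv_lhs => rw [← Finset.univ_sum_single v, map_sum]
  refine Finset.sum_congr rfl fun i _ => ?_
  have : Pi.single i (v i) = v i • (Pi.single i 1 : Fin n → ℝ) := by
    rw [← Pi.single_smul]; simp
  rw [this, map_smul, smul_eq_mul, mul_comm]; rfl

/-- The mean value theorem on the cube. -/
lemma exists_mvt {f : (Fin n → ℝ) → ℝ} (hf : DifferentiableOn ℝ f (cube n)) {x y : Fin n → ℝ}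
    (hx : x ∈ cube n) (hy : y ∈ cube n) :
    ∃ ξ ∈ segment ℝ x y, f y - f x = ∑ i, pderiv i f ξ * (y i - x i) := by
  obtain ⟨ξ, hξ, h⟩ := domain_mvt (fun z hz => (hf z hz).hasFDerivWithinAt)
    (convex_Icc (0 : Fin n → ℝ) 1) hx hy
  exact ⟨ξ, hξ, by rw [h, fderivWithin_cube_apply]; rfl⟩

lemma differentiableOn_pderiv {f : (Fin n → ℝ) → ℝ} (hf : TwiceDifferentiableOnCube f)
    (k : Fin n) : DifferentiableOn ℝ (pderiv k f) (cube n) :=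
  hf.2.clm_apply (differentiableOn_const _)

/-- A first-order Taylor estimate in one coordinate. -/
lemma exists_mvt_update {f : (Fin n → ℝ) → ℝ} (hf : DifferentiableOn ℝ f (cube n))
    {x : Fin n → ℝ} (hx : x ∈ cube n) {k : Fin n} {v : ℝ} (hv : v ∈ Set.Icc (0 : ℝ) 1) :
    ∃ s ∈ Set.Icc (0 : ℝ) 1, Function.update x k s ∈ cube n ∧
      f (Function.update x k v) - f x = pderiv k f (Function.update x k s) * (v - x k) := by
  have hupd : ∀ s ∈ Set.Icc (0 : ℝ) 1, Function.update x k s ∈ cube n := fun s hs =>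
    mem_cube.2 fun i => by
      by_cases h : i = k
      · subst h; simpa using hs
      · simpa [h] using mem_cube.1 hx i
  obtain ⟨ξ, hξ, h⟩ := exists_mvt hf hx (hupd v hv)
  have hξc : ξ ∈ cube n := (convex_Icc _ _).segment_subset hx (hupd v hv) hξ
  have hξeq : ξ = Function.update x k (ξ k) := by
    obtain ⟨α, β, -, -, hαβ, rfl⟩ := hξ
    ext i
    by_cases h : i = k
    · subst h; simp
    · simp [h, ← add_mul, hαβ]
  refine ⟨ξ k, mem_cube.1 hξc k, hξeq ▸ hξc, ?_⟩
  rw [← hξeq, h, Finset.sum_eq_single k]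
  · simp
  · intro i _ hi; simp [hi]
  · simp

/-- The mean value theorem is applied twice, to `f` and then to its partial derivative, so the
second derivative need only exist and be bounded. -/
lemma taylor_update {f : (Fin n → ℝ) → ℝ} (hf : TwiceDifferentiableOnCube f) {k : Fin n} {c : ℝ}
    (hc : ∀ x ∈ cube n, |pderiv k (pderiv k f) x| ≤ c) {x : Fin n → ℝ} (hx : x ∈ cube n) {v : ℝ}
    (hv : v ∈ Set.Icc (0 : ℝ) 1) :
    |f (Function.update x k v) - f x - pderiv k f x * (v - x k)| ≤ c := by
  obtain ⟨s, hs, hsc, h⟩ := exists_mvt_update hf.1 hx hv (k := k)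
  obtain ⟨r, hr, hrc, h'⟩ := exists_mvt_update (differentiableOn_pderiv hf k) hx hs (k := k)
  have hxk := mem_cube.1 hx k
  rw [h, ← sub_mul, h', abs_mul, abs_mul]
  have h1 : |s - x k| ≤ 1 := abs_le.2 ⟨by linarith [hs.1], by linarith [hs.2]⟩
  have h2 : |v - x k| ≤ 1 := abs_le.2 ⟨by linarith [hv.1], by linarith [hv.2]⟩
  have h3 := hc _ hrc
  calc _ ≤ c * 1 * 1 := by
        gcongr
        exact mul_nonneg ((abs_nonneg _).trans h3) zero_le_one
        exact (abs_nonneg _).trans h3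
    _ = c := by ring

lemma abs_update_sub_le {f : (Fin n → ℝ) → ℝ} (hf : DifferentiableOn ℝ f (cube n)) {k : Fin n}
    {b : ℝ} (hb : ∀ x ∈ cube n, |pderiv k f x| ≤ b) {x : Fin n → ℝ} (hx : x ∈ cube n) {v : ℝ}
    (hv : v ∈ Set.Icc (0 : ℝ) 1) : |f (Function.update x k v) - f x| ≤ b := by
  obtain ⟨s, hs, hsc, h⟩ := exists_mvt_update hf hx hv (k := k)
  have hxk := mem_cube.1 hx k
  have h2 : |v - x k| ≤ 1 := abs_le.2 ⟨by linarith [hv.1], by linarith [hv.2]⟩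
  rw [h, abs_mul]
  exact (mul_le_of_le_one_right (abs_nonneg _) h2).trans (hb _ hsc)

/-! ### Concentration under a product measure. -/

/-- A mixture point: the coordinates in `s` come from the vertex `y`, the others from `x`. -/
def mix (s : Finset (Fin n)) (x : Fin n → ℝ) (y : Fin n → Bool) : Fin n → ℝ :=
  fun i => if i ∈ s then vertex y i else x i

lemma mix_mem_cube {x : Fin n → ℝ} (hx : x ∈ cube n) (s : Finset (Fin n)) (y : Fin n → Bool) :
    mix s x y ∈ cube n := mem_cube.2 fun i => by
  by_cases h : i ∈ s
  · simpa [mix, h] using mem_cube.1 (vertex_mem_cube y) i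
  · simpa [mix, h] using mem_cube.1 hx i

/-- Replacing the coordinates of a point of the cube by independent Bernoulli variables with the
same means changes `f` little in mean square. -/
lemma sum_bern_mul_sq_le {f : (Fin n → ℝ) → ℝ} (hf : TwiceDifferentiableOnCube f) {M b : ℝ}
    {c : Fin n → ℝ} (hM : ∀ x ∈ cube n, |f x| ≤ M)
    (hb : ∀ x ∈ cube n, ∀ i, |pderiv i f x| ≤ b)
    (hc : ∀ x ∈ cube n, ∀ i, |pderiv i (pderiv i f) x| ≤ c i) {x : Fin n → ℝ} (hx : x ∈ cube n) :
    ∑ y, bern x y * (f (vertex y) - f x) ^ 2 ≤ ∑ i, (4 * M * c i + b ^ 2) := by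
  suffices h : ∀ s : Finset (Fin n), ∑ y, bern x y * (f (mix s x y) - f x) ^ 2 ≤
      ∑ i ∈ s, (4 * M * c i + b ^ 2) by
    have hmix : ∀ y, mix Finset.univ x y = vertex y := fun y => by ext i; simp [mix]
    simpa [hmix] using h Finset.univ
  intro s
  induction s using Finset.induction_on with
  | empty =>
    have hmix : ∀ y, mix ∅ x y = x := fun y => by ext i; simp [mix]
    simp [hmix]
  | insert k s hk ih =>
    have hM0 : 0 ≤ M := (abs_nonneg _).trans (hM x hx)
    -- Since `k ∉ s`, the mixture point ignores `y k`, while `vertex y k - x k` has mean zero.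
    have hmart : ∑ y, bern x y * ((f (mix s x y) - f x) * (pderiv k f (mix s x y)) *
        (vertex y k - x k)) = 0 := by
      rw [sum_bern_mul x k]
      have h1 : ∀ (y : Fin n → Bool) v, mix s x (Function.update y k v) = mix s x y := by
        intro y v
        ext i
        by_cases h : i ∈ s
        · have : i ≠ k := fun h' => hk (h' ▸ h)
          simp [mix, h, vertex, this]
        · simp [mix, h]
      refine Finset.sum_eq_zero fun y _ => ?_
      simp only [h1]
      simp [vertex]
      ring_nf
      simp
    -- Expand the square. The Taylor remainder contributes at most `2 * (2 * M) * c k`, the squared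
    -- increment at most `b ^ 2`.
    have hpt : ∀ y, (f (mix (insert k s) x y) - f x) ^ 2 ≤ (f (mix s x y) - f x) ^ 2 +
        2 * ((f (mix s x y) - f x) * (pderiv k f (mix s x y)) * (vertex y k - x k)) +
        (4 * M * c k + b ^ 2) := by
      intro y
      have hu := mix_mem_cube hx s y
      have hv := mem_cube.1 (vertex_mem_cube y) k
      have hupd : mix (insert k s) x y = Function.update (mix s x y) k (vertex y k) := by
        ext i
        by_cases h : i = k
        · subst h; simp [mix]
        · simp [mix, h]
      have huk : mix s x y k = x k := by simp [mix, hk]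
      have h1 := taylor_update hf (fun x hx => hc x hx k) hu hv
      have h2 := abs_update_sub_le hf.1 (fun x hx => hb x hx k) hu hv
      rw [← hupd] at h1 h2
      rw [huk] at h1
      have h3 : |f (mix s x y) - f x| ≤ 2 * M :=
        (abs_sub _ _).trans (by linarith [hM _ hu, hM x hx])
      have h4 : (f (mix s x y) - f x) * (f (mix (insert k s) x y) - f (mix s x y) -
          pderiv k f (mix s x y) * (vertex y k - x k)) ≤ 2 * M * c k := by
        refine (le_abs_self _).trans ?_
        rw [abs_mul]
        exact mul_le_mul h3 h1 (abs_nonneg _) (by linarith)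
      have h5 : (f (mix (insert k s) x y) - f (mix s x y)) ^ 2 ≤ b ^ 2 :=
        sq_le_sq' (abs_le.1 h2).1 (abs_le.1 h2).2
      nlinarith
    rw [Finset.sum_insert hk]
    have h := Finset.sum_le_sum fun y (_ : y ∈ Finset.univ) =>
      mul_le_mul_of_nonneg_left (hpt y) (bern_nonneg hx y)
    refine h.trans ?_
    simp only [mul_add (bern x _), Finset.sum_add_distrib, mul_left_comm (bern x _) 2]
    rw [← Finset.mul_sum, hmart]
    simp only [← mul_add, ← Finset.sum_mul, sum_bern]
    simp only [Finset.sum_add_distrib] at ih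
    linarith

/-- Chebyshev's inequality for the deviation of `f` below its value at the mean. -/
lemma le_sum_bern_filter {f : (Fin n → ℝ) → ℝ} {x : Fin n → ℝ} (hx : x ∈ cube n) {K d s : ℝ}
    (hK : ∑ y, bern x y * (f (vertex y) - f x) ^ 2 ≤ K) (hd : 0 < d) (hs : s + d ≤ f x) :
    1 - K / d ^ 2 ≤ ∑ y with s ≤ f (vertex y), bern x y := by
  have h1 : ∀ y, bern x y ≤ (if s ≤ f (vertex y) then bern x y else 0) +
      bern x y * (f (vertex y) - f x) ^ 2 / d ^ 2 := by
    intro y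
    have hb := bern_nonneg hx y
    split_ifs with h
    · have : 0 ≤ bern x y * (f (vertex y) - f x) ^ 2 / d ^ 2 := by positivity
      linarith
    · rw [zero_add, le_div_iff₀ (by positivity)]
      exact mul_le_mul_of_nonneg_left (by nlinarith) hb
  have h2 := Finset.sum_le_sum fun y (_ : y ∈ Finset.univ) => h1 y
  rw [sum_bern, Finset.sum_add_distrib, ← Finset.sum_div, ← Finset.sum_filter] at h2
  have := div_le_div_of_nonneg_right hK (by positivity : 0 ≤ d ^ 2)
  linarith

/-! ### Minimax and sparse convex combinations. -/

/-- If every point of a convex set has some coordinate at least `c`, then some convex combination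
of the coordinates is at least `c` on the whole set. -/
lemma exists_weights {ι : Type*} [Fintype ι] [Nonempty ι] {K : Set (ι → ℝ)} (hK : Convex ℝ K)
    {c : ℝ} (hc : ∀ u ∈ K, ∃ i, c ≤ u i) :
    ∃ w : ι → ℝ, (∀ i, 0 ≤ w i) ∧ ∑ i, w i = 1 ∧ ∀ u ∈ K, c ≤ ∑ i, w i * u i := by
  classical
  rcases K.eq_empty_or_nonempty with rfl | ⟨u₀, hu₀⟩
  · obtain ⟨i₀⟩ := ‹Nonempty ι›
    refine ⟨Pi.single i₀ 1, fun i => ?_, by simp, by simp⟩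
    by_cases h : i = i₀
    · subst h; simp
    · simp [h]
  -- The open orthant below `c` misses `K`. As it is unbounded below, a separating functional has
  -- nonnegative coefficients, which become the weights.
  let N : Set (ι → ℝ) := Set.univ.pi fun _ => Set.Iio c
  have hN : Convex ℝ N := convex_pi fun _ _ => convex_Iio c
  have hNo : IsOpen N := isOpen_set_pi Set.finite_univ fun _ _ => isOpen_Iio
  have hd : Disjoint N K := Set.disjoint_left.2 fun u hu hu' => by
    obtain ⟨i, hi⟩ := hc u hu'
    exact absurd (hu i trivial) (not_lt.2 hi)
  obtain ⟨g, r, hg1, hg2⟩ := geometric_hahn_banach_open hN hNo hK hd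
  let G : ι → ℝ := fun i => g (Pi.single i 1)
  have hG : ∀ u, g u = ∑ i, G i * u i := by
    intro u
    conv_lhs => rw [← Finset.univ_sum_single u, map_sum]
    refine Finset.sum_congr rfl fun i _ => ?_
    have : Pi.single i (u i) = u i • (Pi.single i 1 : ι → ℝ) := by
      rw [← Pi.single_smul]; simp
    rw [this, map_smul, smul_eq_mul, mul_comm]
  have hlow : ∀ u : ι → ℝ, (∀ i, 0 < u i) → (∑ i, G i) * c - r < ∑ i, G i * u i := by
    intro u hu
    have h := hg1 (fun i => c - u i) (fun i _ => by simp [hu i])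
    rw [hG] at h
    simp only [mul_sub, Finset.sum_sub_distrib, ← Finset.sum_mul] at h
    linarith
  -- Let all coordinates of `u` except `i₀` tend to 0. Then `s = 0` bounds `r`, and large `s` forces
  -- `G i₀ ≥ 0`.
  have hcont : ∀ i₀ : ι, ∀ s : ℝ, 0 ≤ s → (∑ i, G i) * c - r ≤ G i₀ * s := by
    intro i₀ s hs
    have ht : Tendsto (fun η : ℝ => ∑ i, G i * ((if i = i₀ then s else 0) + η)) (𝓝[>] 0)
        (𝓝 (∑ i, G i * ((if i = i₀ then s else 0) + 0))) := by
      refine Tendsto.mono_left (Continuous.tendsto ?_ 0) nhdsWithin_le_nhds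
      fun_prop
    have h := ge_of_tendsto ht (b := (∑ i, G i) * c - r) (by
      filter_upwards [self_mem_nhdsWithin] with η (hη : 0 < η)
      exact (hlow _ fun i => by split_ifs <;> linarith).le)
    simpa using h
  obtain ⟨i₁⟩ := ‹Nonempty ι›
  have hr : (∑ i, G i) * c ≤ r := by
    have := hcont i₁ 0 le_rfl
    linarith
  have hGnn : ∀ i, 0 ≤ G i := by
    intro i
    by_contra! hneg
    have h := hcont i ((((∑ i, G i) * c - r) - 1) / G i)
      (div_nonneg_of_nonpos (by linarith) hneg.le)
    rw [mul_div_cancel₀ _ hneg.ne] at h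
    linarith
  have hGpos : 0 < ∑ i, G i := by
    refine (Finset.sum_nonneg fun i _ => hGnn i).lt_of_ne fun h => ?_
    have hz : ∀ i, G i = 0 := fun i =>
      (Finset.sum_eq_zero_iff_of_nonneg fun i _ => hGnn i).1 h.symm i (Finset.mem_univ i)
    have h1 := hg1 (fun _ => c - 1) (fun i _ => by simp)
    have h2 := hg2 u₀ hu₀
    rw [hG] at h1 h2
    simp [hz] at h1 h2
    linarith
  refine ⟨fun i => G i / ∑ i, G i, fun i => div_nonneg (hGnn i) hGpos.le, ?_, fun u hu => ?_⟩
  · rw [← Finset.sum_div, div_self hGpos.ne']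
  · have h2 := hg2 u hu
    rw [hG] at h2
    simp only [div_mul_eq_mul_div, ← Finset.sum_div]
    rw [le_div_iff₀ hGpos]
    linarith

/-- Maurey's approximate Carathéodory theorem: a convex combination is approximated by averages of
`k` of the points. -/
lemma exists_sum_close {ι : Type*} [Fintype ι] {w : ι → ℝ} (hw : ∀ z, 0 ≤ w z)
    (hw1 : ∑ z, w z = 1) {a : ι → Fin n → ℝ} {R : ℝ} (hR : ∀ z, ∑ i, a z i ^ 2 ≤ R) (k : ℕ) :
    ∃ l : Fin k → ι, ∑ i, (∑ j, a (l j) i - k * ∑ z, w z * a z i) ^ 2 ≤ k * R := by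
  induction k with
  | zero => exact ⟨Fin.elim0, by simp⟩
  | succ k ih =>
    obtain ⟨l, hl⟩ := ih
    set v : Fin n → ℝ := fun i => ∑ z, w z * a z i with hv
    set s : Fin n → ℝ := fun i => ∑ j, a (l j) i - k * v i with hs
    -- For `z` drawn from `w`, `a z - v` is centred, so the cross term vanishes and the variance is
    -- at most the second moment. Some `z` then does no worse than average.
    have hcoord : ∀ i, ∑ z, w z * (s i + a z i - v i) ^ 2 ≤ s i ^ 2 + ∑ z, w z * a z i ^ 2 := by
      intro i
      have h1 : ∀ z, w z * (s i + a z i - v i) ^ 2 =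
          w z * (s i - v i) ^ 2 + 2 * (s i - v i) * (w z * a z i) + w z * a z i ^ 2 :=
        fun z => by ring
      simp_rw [h1]
      rw [Finset.sum_add_distrib, Finset.sum_add_distrib, ← Finset.sum_mul, ← Finset.mul_sum, hw1]
      change 1 * (s i - v i) ^ 2 + 2 * (s i - v i) * v i + _ ≤ _
      nlinarith [sq_nonneg (v i)]
    have havg : ∑ z, w z * ∑ i, (s i + a z i - v i) ^ 2 ≤ k * R + R := by
      calc ∑ z, w z * ∑ i, (s i + a z i - v i) ^ 2
          = ∑ i, ∑ z, w z * (s i + a z i - v i) ^ 2 := by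
            simp_rw [Finset.mul_sum]; exact Finset.sum_comm
        _ ≤ ∑ i, (s i ^ 2 + ∑ z, w z * a z i ^ 2) := Finset.sum_le_sum fun i _ => hcoord i
        _ = ∑ i, s i ^ 2 + ∑ z, w z * ∑ i, a z i ^ 2 := by
            rw [Finset.sum_add_distrib, Finset.sum_comm]; simp_rw [Finset.mul_sum]
        _ ≤ k * R + ∑ z, w z * R :=
            add_le_add hl (Finset.sum_le_sum fun z _ => mul_le_mul_of_nonneg_left (hR z) (hw z))
        _ = k * R + R := by rw [← Finset.sum_mul, hw1, one_mul]
    obtain ⟨z, hz⟩ : ∃ z, ∑ i, (s i + a z i - v i) ^ 2 ≤ k * R + R := by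
      by_contra! hcon
      obtain ⟨z₀, hz₀⟩ : ∃ z, 0 < w z := by
        by_contra! h0
        have := Finset.sum_nonpos fun z (_ : z ∈ Finset.univ) => h0 z
        linarith
      have : ∑ z, w z * (k * R + R) < ∑ z, w z * ∑ i, (s i + a z i - v i) ^ 2 :=
        Finset.sum_lt_sum (fun z _ => mul_le_mul_of_nonneg_left (hcon z).le (hw z))
          ⟨z₀, Finset.mem_univ _, mul_lt_mul_of_pos_left (hcon z₀) hz₀⟩
      rw [← Finset.sum_mul, hw1, one_mul] at this
      linarith
    refine ⟨Fin.cons z l, ?_⟩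
    have heq : ∀ i, ∑ j, a ((Fin.cons z l : Fin (k + 1) → ι) j) i - ((k + 1 : ℕ) : ℝ) * v i =
        s i + a z i - v i := by
      intro i
      rw [Fin.sum_univ_succ]
      simp only [Fin.cons_zero, Fin.cons_succ, hs]
      push_cast
      ring
    calc _ = ∑ i, (s i + a z i - v i) ^ 2 :=
          Finset.sum_congr rfl fun i _ => congrArg (· ^ 2) (heq i)
      _ ≤ _ := by push_cast; linarith

/-! ### Covering the event by separated sets. -/

/-- The large deviation upper bound for a function with a finite gradient net. -/
lemma sum_bern_filter_le {f : (Fin n → ℝ) → ℝ} (hf : DifferentiableOn ℝ f (cube n)) {b : ℝ}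
    (hb : ∀ x ∈ cube n, ∀ i, |pderiv i f x| ≤ b) {p : ℝ} (hp : p ∈ Set.Ioo (0 : ℝ) 1)
    (hn : 1 ≤ n) {ε δ s R : ℝ} (hε1 : ε ≤ 1) (hδ : 0 < δ) (hεδ : ε ≤ δ / 4) {k : ℕ}
    (hk : 16 * (2 * b ^ 2 + 2) ≤ k * δ ^ 2) {D : Finset (Fin n → ℝ)} (hD : IsGradientNet f ε D)
    (hR : ∀ x ∈ cube n, s - δ * n ≤ f x → R ≤ ∑ i, entropy p (x i)) :
    ∑ y with s ≤ f (vertex y), bern (fun _ => p) y ≤ (D.card : ℝ) ^ k * Real.exp (-R) := by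
  classical
  have hn0 : (0 : ℝ) < n := by exact_mod_cast hn
  have hk0 : (0 : ℝ) < k := by
    by_contra! h
    nlinarith [sq_nonneg b, sq_nonneg δ]
  have hε0 : 0 < ε := by
    obtain ⟨z, -, hz⟩ := hD 0 (mem_cube.2 fun _ => ⟨le_rfl, zero_le_one⟩)
    exact pos_of_mul_pos_left ((Real.sqrt_nonneg _).trans_lt hz) (Real.sqrt_nonneg _)
  -- Net vectors within `ε √n` of a gradient have squared norm at most `2 b² n + 2 ε² n ≤ Q`. `D'`
  -- discards the longer ones.
  set Q : ℝ := (2 * b ^ 2 + 2) * n with hQ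
  let D' := D.filter fun z => ∑ i, z i ^ 2 ≤ Q
  let S : Set (Fin n → ℝ) := {x | x ∈ cube n ∧ ∑ i, entropy p (x i) < R}
  have hnet : ∀ x ∈ cube n, ∃ z ∈ D', ∑ i, (pderiv i f x - z i) ^ 2 ≤ ε ^ 2 * n := by
    intro x hx
    obtain ⟨z, hzD, hz⟩ := hD x hx
    have h1 : ∑ i, (pderiv i f x - z i) ^ 2 ≤ ε ^ 2 * n := by
      have h := Real.sqrt_le_iff.1 hz.le
      rw [mul_pow, Real.sq_sqrt hn0.le] at h
      exact h.2
    refine ⟨z, Finset.mem_filter.2 ⟨hzD, ?_⟩, h1⟩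
    have h2 : ∀ i, z i ^ 2 ≤ 2 * b ^ 2 + 2 * (pderiv i f x - z i) ^ 2 := by
      intro i
      have := sq_le_sq' (abs_le.1 (hb x hx i)).1 (abs_le.1 (hb x hx i)).2
      nlinarith [sq_nonneg (2 * pderiv i f x - z i)]
    calc ∑ i, z i ^ 2 ≤ ∑ i, (2 * b ^ 2 + 2 * (pderiv i f x - z i) ^ 2) :=
          Finset.sum_le_sum fun i _ => h2 i
      _ = n * (2 * b ^ 2) + 2 * ∑ i, (pderiv i f x - z i) ^ 2 := by
          rw [Finset.sum_add_distrib, Finset.sum_const, Finset.card_univ, Fintype.card_fin,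
            nsmul_eq_mul, ← Finset.mul_sum]
      _ ≤ Q := by
          have : ε ^ 2 ≤ 1 := by nlinarith
          nlinarith
  have hcs : ∀ {g u x : Fin n → ℝ} {r : ℝ}, 0 ≤ r → u ∈ cube n → x ∈ cube n →
      ∑ i, g i ^ 2 ≤ r ^ 2 * n → |∑ i, g i * (u i - x i)| ≤ r * n := by
    intro g u x r hr hu hx hg
    have h1 : ∑ i, (u i - x i) ^ 2 ≤ n := by
      calc ∑ i, (u i - x i) ^ 2 ≤ ∑ _i : Fin n, (1 : ℝ) := Finset.sum_le_sum fun i _ => by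
            have h1 := mem_cube.1 hu i
            have h2 := mem_cube.1 hx i
            exact (sq_le_one_iff_abs_le_one _).2 (abs_le.2 ⟨by linarith, by linarith⟩)
        _ = n := by simp
    refine abs_le_of_sq_le_sq ?_ (by positivity)
    calc _ ≤ (∑ i, g i ^ 2) * ∑ i, (u i - x i) ^ 2 := Finset.sum_mul_sq_le_sq_mul_sq _ _ _
      _ ≤ (r ^ 2 * n) * n := mul_le_mul hg h1 (Finset.sum_nonneg fun i _ => sq_nonneg _)
          (by positivity)
      _ = (r * n) ^ 2 := by ring
  -- `f` rises by more than `δ n` from `x` to `y`; replacing the gradient by `z` costs at most `ε n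
  -- ≤ δ n / 4`.
  have hsep : ∀ y, s ≤ f (vertex y) → ∀ x ∈ S, ∃ z : D', 3 / 4 * δ * n ≤
      ∑ i, z.1 i * (vertex y i - x i) := by
    intro y hy x hx
    obtain ⟨ξ, hξ, h⟩ := exists_mvt hf hx.1 (vertex_mem_cube y)
    obtain ⟨z, hz, hz'⟩ := hnet ξ (convex_cube.segment_subset hx.1 (vertex_mem_cube y) hξ)
    refine ⟨⟨z, hz⟩, ?_⟩
    have h1 : f x < s - δ * n := by
      by_contra! h1
      exact absurd (hR x hx.1 h1) (not_le.2 hx.2)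
    have h2 := (abs_le.1 (hcs hε0.le (vertex_mem_cube y) hx.1 hz')).2
    simp only [sub_mul, Finset.sum_sub_distrib] at h2
    have h3 : ε * n ≤ δ / 4 * n := mul_le_mul_of_nonneg_right hεδ hn0.le
    simp only
    linarith
  have : Nonempty D' := by
    obtain ⟨z, hz, -⟩ := hnet 0 (mem_cube.2 fun _ => ⟨le_rfl, zero_le_one⟩)
    exact ⟨⟨z, hz⟩⟩
  let H : (Fin k → Fin n → ℝ) → Finset (Fin n → Bool) := fun l =>
    {y | ∀ x ∈ S, 0 < ∑ i, (∑ j, l j i) * (vertex y i - x i)}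
  have hcover : ∀ y, s ≤ f (vertex y) → ∃ l ∈ Fintype.piFinset fun _ : Fin k => D, y ∈ H l := by
    intro y hy
    obtain ⟨w, hw0, hw1, hw⟩ := exists_weights
      (K := (fun x => fun z : D' => ∑ i, z.1 i * (vertex y i - x i)) '' S) (c := 3 / 4 * δ * n)
      (by
        rintro _ ⟨x, hx, rfl⟩ _ ⟨x', hx', rfl⟩ α β hα hβ hαβ
        refine ⟨α • x + β • x', convex_entropy_lt hp R hx hx' hα hβ hαβ, ?_⟩
        ext z
        simp only [Pi.add_apply, Pi.smul_apply, smul_eq_mul, Finset.mul_sum]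
        rw [← Finset.sum_add_distrib]
        refine Finset.sum_congr rfl fun i _ => ?_
        obtain rfl : β = 1 - α := by linarith
        ring)
      (by rintro _ ⟨x, hx, rfl⟩; exact hsep y hy x hx)
    obtain ⟨l, hl⟩ := exists_sum_close hw0 hw1 (a := fun z : D' => z.1) (R := Q)
      (fun z => (Finset.mem_filter.1 z.2).2) k
    refine ⟨fun j => (l j).1, Fintype.mem_piFinset.2 fun j => (Finset.mem_filter.1 (l j).2).1, ?_⟩
    simp only [H, Finset.mem_filter, Finset.mem_univ, true_and]
    intro x hx
    have h1 := hw _ ⟨x, hx, rfl⟩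
    -- The choice of `k` makes the Maurey error at most `k δ n / 4`, against a separation of `3 k δ
    -- n / 4`.
    have h2 : ∑ i, (∑ j, (l j).1 i - k * ∑ z, w z * z.1 i) ^ 2 ≤ (k * δ / 4) ^ 2 * n := by
      refine hl.trans ?_
      rw [hQ]
      have : (k * δ / 4) ^ 2 * n = k * ((k * δ ^ 2) / 16 * n) := by ring
      rw [this]
      gcongr
      linarith
    have h3 := (abs_le.1 (hcs (by positivity) (vertex_mem_cube y) hx.1 h2)).1
    have h4 : ∑ i, (∑ z, w z * z.1 i) * (vertex y i - x i) =
        ∑ z, w z * ∑ i, z.1 i * (vertex y i - x i) := by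
      simp_rw [Finset.sum_mul, Finset.mul_sum]
      rw [Finset.sum_comm]
      simp_rw [mul_assoc]
    simp only [sub_mul, Finset.sum_sub_distrib, mul_assoc (k : ℝ)] at h3
    rw [← Finset.mul_sum] at h3
    have h5 : 0 < k * (δ * n) := by positivity
    have h6 := mul_le_mul_of_nonneg_left h1 hk0.le
    simp only at h6
    rw [h4] at h3
    nlinarith
  have hH : ∀ l, ∑ y ∈ H l, bern (fun _ => p) y ≤ Real.exp (-R) := by
    intro l
    rcases (H l).eq_empty_or_nonempty with h | h
    · rw [h, Finset.sum_empty]; exact (Real.exp_pos _).le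
    · obtain ⟨x, hx, hle, hz⟩ := exists_barycentre hp h
      refine hle.trans (Real.exp_le_exp.2 (neg_le_neg ?_))
      -- A barycentre in `S` would be strictly separated from every `y ∈ H l`, yet some `y` does not
      -- exceed it in direction `∑ j, l j`.
      by_contra! hlt
      obtain ⟨y, hy, hyz⟩ := hz fun i => ∑ j, l j i
      have := (Finset.mem_filter.1 hy).2 x ⟨hx, hlt⟩
      simp only [mul_sub, Finset.sum_sub_distrib] at this
      linarith
  calc ∑ y with s ≤ f (vertex y), bern (fun _ => p) y
      ≤ ∑ y, ∑ l ∈ Fintype.piFinset fun _ : Fin k => D,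
          if y ∈ H l then bern (fun _ => p) y else 0 := by
        have h0 : ∀ (y : Fin n → Bool) l, 0 ≤ if y ∈ H l then bern (fun _ => p) y else 0 :=
          fun y l => by split_ifs; exacts [(bern_const_pos hp y).le, le_rfl]
        rw [Finset.sum_filter]
        refine Finset.sum_le_sum fun y _ => ?_
        split_ifs with hy
        · obtain ⟨l, hl, hyl⟩ := hcover y hy
          refine le_trans (by rw [if_pos hyl]) (Finset.single_le_sum
            (f := fun l => if y ∈ H l then bern (fun _ => p) y else 0) (fun l _ => h0 y l) hl)
        · exact Finset.sum_nonneg fun l _ => h0 y l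
    _ = ∑ l ∈ Fintype.piFinset fun _ : Fin k => D, ∑ y ∈ H l, bern (fun _ => p) y := by
        rw [Finset.sum_comm]
        refine Finset.sum_congr rfl fun l _ => ?_
        rw [Finset.sum_ite_mem, Finset.univ_inter]
    _ ≤ ∑ l ∈ Fintype.piFinset fun _ : Fin k => D, Real.exp (-R) :=
        Finset.sum_le_sum fun l _ => hH l
    _ = (D.card : ℝ) ^ k * Real.exp (-R) := by
        simp [Fintype.card_piFinset]

/-! ### The law of `Y` and the limits. -/

/-- The law of a vector of independent Bernoulli variables. -/
lemma measureReal_eq_sum_bern {p : ℝ} (hp : p ∈ Set.Ioo (0 : ℝ) 1) {Ω : Type*}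
    [MeasurableSpace Ω] {P : Measure Ω} [IsProbabilityMeasure P] {Y : Fin n → Ω → ℝ}
    (hYm : ∀ i, Measurable (Y i)) (hYind : iIndepFun Y P)
    (hY₁ : ∀ i, P {ω | Y i ω = 1} = ENNReal.ofReal p)
    (hY₀ : ∀ i, P {ω | Y i ω = 0} = ENNReal.ofReal (1 - p)) (f : (Fin n → ℝ) → ℝ) (s : ℝ) :
    P.real {ω | s ≤ f (fun i => Y i ω)} =
      ∑ y with s ≤ f (vertex y), bern (fun _ => p) y := by
  classical
  have hp' : 0 ≤ 1 - p := by linarith [hp.2]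
  have hone : ∀ i, ∀ c : Bool, P {ω | Y i ω = cond c 1 0} =
      ENNReal.ofReal (cond c p (1 - p)) := by
    intro i c; cases c
    · exact hY₀ i
    · exact hY₁ i
  let E : (Fin n → Bool) → Set Ω := fun y => {ω | ∀ i, Y i ω = vertex y i}
  have hEeq : ∀ y, E y = ⋂ i ∈ (Finset.univ : Finset (Fin n)), Y i ⁻¹' {vertex y i} := by
    intro y; ext ω; simp [E]
  have hEm : ∀ y, MeasurableSet (E y) := fun y => by
    rw [hEeq]
    exact Finset.measurableSet_biInter _ fun i _ => hYm i (measurableSet_singleton _)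
  have hE : ∀ y, P.real (E y) = bern (fun _ => p) y := by
    intro y
    have h := hYind.measure_inter_preimage_eq_mul Finset.univ
      (sets := fun i => {vertex y i}) fun i _ => measurableSet_singleton _
    rw [Measure.real, hEeq, h, ENNReal.toReal_prod]
    refine Finset.prod_congr rfl fun i _ => ?_
    have h1 : P (Y i ⁻¹' {vertex y i}) = ENNReal.ofReal (cond (y i) p (1 - p)) := hone i (y i)
    rw [h1, ENNReal.toReal_ofReal]
    cases y i
    · exact hp'
    · exact hp.1.le
  have hdisj : ∀ T : Finset (Fin n → Bool), (T : Set (Fin n → Bool)).PairwiseDisjoint E := by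
    intro T y _ y' _ hne
    refine Set.disjoint_left.2 fun ω h h' => hne ?_
    ext i
    have := (h i).symm.trans (h' i)
    cases h1 : y i <;> cases h2 : y' i <;> simp [vertex, h1, h2] at this ⊢
  have hunion : ∀ T : Finset (Fin n → Bool),
      P.real (⋃ y ∈ T, E y) = ∑ y ∈ T, bern (fun _ => p) y := by
    intro T
    rw [measureReal_biUnion_finset (hdisj T) fun y _ => hEm y]
    exact Finset.sum_congr rfl fun y _ => hE y
  -- Almost surely `Y` is a vertex, so the event agrees a.e. with a finite union of the `E y`,
  -- whether or not `f` is measurable.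
  have hae : ∀ᵐ ω ∂P, ω ∈ ⋃ y ∈ (Finset.univ : Finset (Fin n → Bool)), E y := by
    refine (mem_ae_iff_prob_eq_one (Finset.measurableSet_biUnion _ fun y _ => hEm y)).2 ?_
    rw [← ENNReal.toReal_eq_one_iff]
    exact (hunion _).trans (sum_bern _)
  rw [← hunion]
  refine measureReal_congr ?_
  filter_upwards [hae] with ω hω
  obtain ⟨y, -, hy⟩ := Set.mem_iUnion₂.1 hω
  have hYy : (fun i => Y i ω) = vertex y := funext hy
  refine propext ?_
  change s ≤ f (fun i => Y i ω) ↔ ω ∈ ⋃ y ∈ _, E y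
  rw [hYy]
  constructor
  · intro h
    exact Set.mem_iUnion₂.2 ⟨y, by simpa using h, hy⟩
  · intro h
    obtain ⟨y', hy', hωy'⟩ := Set.mem_iUnion₂.1 h
    have : vertex y' = vertex y := by rw [← hYy]; exact (funext hωy').symm
    rw [← this]
    simpa using hy'

lemma rate_nonneg {f : (Fin n → ℝ) → ℝ} {p : ℝ} (hp : p ∈ Set.Ioo (0 : ℝ) 1) (t : ℝ) :
    0 ≤ rate f p t := by
  refine le_iInf fun x => le_iInf fun hx => le_iInf fun _ => EReal.coe_nonneg.2 ?_
  exact div_nonneg (Finset.sum_nonneg fun i _ => entropy_nonneg hp (mem_cube.1 hx i))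
    (Nat.cast_nonneg n)

/-- The large deviation lower bound. -/
lemma eventually_log_ge {f : (n : ℕ) → (Fin n → ℝ) → ℝ}
    (hf : ∀ n, 1 ≤ n → TwiceDifferentiableOnCube (f n)) {a b : ℝ}
    (ha : ∀ n, 1 ≤ n → ∀ x ∈ cube n, |f n x| ≤ a * n)
    (hb : ∀ n, 1 ≤ n → ∀ x ∈ cube n, ∀ i, |pderiv i (f n) x| ≤ b)
    {c : (n : ℕ) → Fin n → ℝ}
    (hc : ∀ n, 1 ≤ n → ∀ x ∈ cube n, ∀ i, |pderiv i (pderiv i (f n)) x| ≤ c n i)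
    (hc₃ : (fun n => ∑ i, c n i) =o[atTop] (fun n : ℕ => (n : ℝ)))
    {p : ℝ} (hp : p ∈ Set.Ioo (0 : ℝ) 1) {t δ η L : ℝ} (hδ : 0 < δ) (hη : 0 < η) (hL : 0 ≤ L)
    (hrate : ∀ᶠ n in atTop, rate (f n) p (t + δ) < ((L + η / 4 : ℝ) : EReal)) :
    ∀ᶠ n : ℕ in atTop, 0 < ∑ y with t * n ≤ f n (vertex y), bern (fun _ => p) y ∧
      -(L + η) * n ≤ Real.log (∑ y with t * n ≤ f n (vertex y), bern (fun _ => p) y) := by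
  -- Chosen so that `(1 - θ) (L + η) = L + η / 2`; the slack `η / 2` splits between near-minimality
  -- of `x` and `log 2 / n`.
  set θ : ℝ := η / (2 * (L + η)) with hθ
  have hLη : 0 < L + η := by linarith
  have hθ0 : 0 < θ := by positivity
  have hθmul : (1 - θ) * (L + η) = L + η / 2 := by rw [hθ]; field_simp; ring
  have hθ1 : θ < 1 := by rw [hθ, div_lt_one (by positivity)]; linarith
  have hK : Tendsto (fun n : ℕ => (∑ i, (4 * (a * n) * c n i + b ^ 2)) / (δ * n) ^ 2)
      atTop (𝓝 0) := by
    have h1 := (hc₃.tendsto_div_nhds_zero.const_mul (4 * a / δ ^ 2)).add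
      (tendsto_const_div_atTop_nhds_zero_nat (b ^ 2 / δ ^ 2))
    rw [mul_zero, add_zero] at h1
    refine h1.congr' ?_
    filter_upwards [eventually_ge_atTop 1] with n hn
    have hn0 : (n : ℝ) ≠ 0 := by positivity
    rw [Finset.sum_add_distrib, ← Finset.mul_sum, Finset.sum_const, Finset.card_univ,
      Fintype.card_fin, nsmul_eq_mul]
    field_simp
  have hlog : ∀ᶠ n : ℕ in atTop, Real.log 2 / (η / 4) ≤ n :=
    tendsto_natCast_atTop_atTop.eventually_ge_atTop _
  filter_upwards [hrate, hK.eventually_lt_const hθ0, hlog, eventually_ge_atTop 1]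
    with n hr hKn hln hn
  have hn0 : (0 : ℝ) < n := by exact_mod_cast hn
  simp only [rate, iInf_lt_iff, EReal.coe_lt_coe_iff] at hr
  obtain ⟨x, hx, hfx, hent⟩ := hr
  rw [div_lt_iff₀ hn0] at hent
  rw [div_le_iff₀ (by positivity)] at hln
  have hq := le_sum_bern_filter hx
    (sum_bern_mul_sq_le (hf n hn) (ha n hn) (hb n hn) (hc n hn) hx)
    (d := δ * n) (s := t * n) (by positivity) (by linarith)
  set A : Finset (Fin n → Bool) := {y | t * n ≤ f n (vertex y)} with hA
  have hAne : A.Nonempty := by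
    by_contra h
    rw [Finset.not_nonempty_iff_eq_empty] at h
    rw [h, Finset.sum_empty] at hq
    linarith
  have hpos : 0 < ∑ y ∈ A, bern (fun _ => p) y :=
    Finset.sum_pos (fun y _ => bern_const_pos hp y) hAne
  refine ⟨hpos, ?_⟩
  have h := neg_entropy_le_log_bern hp hx hAne
  have hle : ∑ y ∈ A, bern (fun _ => p) y ≤ 1 := by
    rw [← sum_bern fun _ : Fin n => p]
    exact Finset.sum_le_univ_sum_of_nonneg fun y => (bern_const_pos hp y).le
  have hlog0 := Real.log_nonpos hpos.le hle
  by_contra! hlt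
  have h1 : (∑ y ∈ A, bern x y) * Real.log (∑ y ∈ A, bern (fun _ => p) y) ≤
      (1 - θ) * Real.log (∑ y ∈ A, bern (fun _ => p) y) :=
    mul_le_mul_of_nonpos_right (by linarith) hlog0
  have h2 := mul_lt_mul_of_pos_left hlt (by linarith : 0 < 1 - θ)
  have h3 : (1 - θ) * (-(L + η) * n) = -((L + η / 2) * n) := by rw [← hθmul]; ring
  linarith

/-- The large deviation upper bound. -/
lemma eventually_log_le {f : (n : ℕ) → (Fin n → ℝ) → ℝ}
    (hf : ∀ n, 1 ≤ n → DifferentiableOn ℝ (f n) (cube n)) {b : ℝ}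
    (hb : ∀ n, 1 ≤ n → ∀ x ∈ cube n, ∀ i, |pderiv i (f n) x| ≤ b)
    (hC : Tendsto (fun n => gradientComplexity (f n)) atTop (𝓝 0))
    {p : ℝ} (hp : p ∈ Set.Ioo (0 : ℝ) 1) {t δ η L : ℝ} (hδ : 0 < δ) (hη : 0 < η)
    (hrate : ∀ᶠ n in atTop, ((L - η / 2 : ℝ) : EReal) < rate (f n) p (t - δ)) :
    ∀ᶠ n : ℕ in atTop, 0 < ∑ y with t * n ≤ f n (vertex y), bern (fun _ => p) y →
      Real.log (∑ y with t * n ≤ f n (vertex y), bern (fun _ => p) y) ≤ (-L + η) * n := by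
  obtain ⟨k, hk⟩ := exists_nat_ge (16 * (2 * b ^ 2 + 2) / δ ^ 2)
  rw [div_le_iff₀ (by positivity)] at hk
  -- A complexity below `θ` bounds both `ε` and `log |D| / n` by `θ`, as both are nonnegative. The
  -- last entry gives `k log |D| ≤ η n / 2`.
  set θ : ℝ := min (min (δ / 4) 1) (η / (2 * (k + 1))) with hθ
  have hθ0 : 0 < θ := by positivity
  filter_upwards [hrate, hC.eventually_lt_const (EReal.coe_pos.2 hθ0), eventually_ge_atTop 1]
    with n hr hCn hn hpos
  have hn0 : (0 : ℝ) < n := by exact_mod_cast hn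
  simp only [gradientComplexity, iInf_lt_iff, EReal.coe_lt_coe_iff] at hCn
  obtain ⟨ε, hε, D, hD, hlt⟩ := hCn
  have hDpos : (0 : ℝ) < D.card := by
    obtain ⟨z, hz, -⟩ := hD 0 (mem_cube.2 fun _ => ⟨le_rfl, zero_le_one⟩)
    exact_mod_cast Finset.card_pos.2 ⟨z, hz⟩
  have hlogD : 0 ≤ Real.log D.card / n := div_nonneg (Real.log_natCast_nonneg _) hn0.le
  have hεθ : ε ≤ θ := by linarith
  have hbound := sum_bern_filter_le (hf n hn) (hb n hn) hp hn (s := t * n)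
    (R := (L - η / 2) * n)
    (hεθ.trans ((min_le_left _ _).trans (min_le_right _ _))) hδ
    (hεθ.trans ((min_le_left _ _).trans (min_le_left _ _))) hk hD (by
      intro x hx hfx
      have h1 : rate (f n) p (t - δ) ≤ (((∑ i, entropy p (x i)) / n : ℝ) : EReal) :=
        iInf_le_of_le x (iInf_le_of_le hx (iInf_le_of_le (by linarith) le_rfl))
      have h2 := EReal.coe_lt_coe_iff.1 (hr.trans_le h1)
      exact ((lt_div_iff₀ hn0).1 h2).le)
  have h1 := Real.log_le_log hpos hbound
  rw [Real.log_mul (pow_pos hDpos k).ne' (Real.exp_pos _).ne', Real.log_exp, Real.log_pow] at h1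
  have h2 : Real.log D.card ≤ η / (2 * (k + 1)) * n := by
    rw [← div_le_iff₀ hn0]
    have h3 : Real.log D.card / n ≤ θ := by linarith
    exact h3.trans (min_le_right _ _)
  have h3 : (k : ℝ) * Real.log D.card ≤ η / 2 * n := by
    calc (k : ℝ) * Real.log D.card ≤ (k + 1) * (η / (2 * (k + 1)) * n) :=
          mul_le_mul (by linarith) h2 (Real.log_natCast_nonneg _) (by positivity)
      _ = η / 2 * n := by field_simp
  linarith

end NonlinearLD

theorem theorem9p1
    (f : (n : ℕ) → (Fin n → ℝ) → ℝ)
    (hf : ∀ n, 1 ≤ n → NonlinearLD.TwiceDifferentiableOnCube (f n))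
    (a b : ℝ)
    (ha : ∀ n, 1 ≤ n → ∀ x ∈ NonlinearLD.cube n, |f n x| ≤ a * n)
    (hb : ∀ n, 1 ≤ n → ∀ x ∈ NonlinearLD.cube n, ∀ i, |NonlinearLD.pderiv i (f n) x| ≤ b)
    (c : (n : ℕ) → Fin n → Fin n → ℝ)
    (hc : ∀ n, 1 ≤ n → ∀ x ∈ NonlinearLD.cube n, ∀ i j,
      |NonlinearLD.pderiv i (NonlinearLD.pderiv j (f n)) x| ≤ c n i j)
    (hC : Tendsto (fun n => NonlinearLD.gradientComplexity (f n)) atTop (𝓝 0))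
    (hc₁ : (fun n => ∑ i, ∑ j, c n i j) =o[atTop] (fun n : ℕ => (n : ℝ) ^ 2))
    (hc₂ : (fun n => ∑ i, ∑ j, c n i j ^ 2) =o[atTop] (fun n : ℕ => (n : ℝ)))
    (hc₃ : (fun n => ∑ i, c n i i) =o[atTop] (fun n : ℕ => (n : ℝ)))
    (p : ℝ) (hp : p ∈ Set.Ioo (0 : ℝ) 1)
    (φ : ℝ → EReal)
    (hφ : ∀ s : ℝ, Tendsto (fun n => NonlinearLD.rate (f n) p s) atTop (𝓝 (φ s)))
    {Ω : ℕ → Type*} [∀ n, MeasurableSpace (Ω n)]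
    (P : (n : ℕ) → Measure (Ω n)) [∀ n, IsProbabilityMeasure (P n)]
    (Y : (n : ℕ) → Fin n → Ω n → ℝ)
    (hYm : ∀ n i, Measurable (Y n i))
    (hYind : ∀ n, iIndepFun (Y n) (P n))
    (hY₁ : ∀ n i, P n {ω | Y n i ω = 1} = ENNReal.ofReal p)
    (hY₀ : ∀ n i, P n {ω | Y n i ω = 0} = ENNReal.ofReal (1 - p))
    (t : ℝ) (ht : ContinuousAt φ t) (htfin : φ t ≠ ⊤) :
    (∀ᶠ n in atTop, 0 < P n {ω | t * n ≤ f n (fun i => Y n i ω)}) ∧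
    Tendsto (fun n : ℕ => Real.log ((P n).real {ω | t * n ≤ f n (fun i => Y n i ω)}) / n)
      atTop (𝓝 (-(φ t).toReal)) := by
  have hφ0 : 0 ≤ φ t := ge_of_tendsto' (hφ t) fun n => NonlinearLD.rate_nonneg hp t
  obtain ⟨L, hL⟩ : ∃ L : ℝ, φ t = L :=
    ⟨_, (EReal.coe_toReal htfin (EReal.bot_lt_zero.trans_le hφ0).ne').symm⟩
  have hL0 : 0 ≤ L := by rw [hL] at hφ0; exact EReal.coe_nonneg.1 hφ0
  have hreal := fun n => NonlinearLD.measureReal_eq_sum_bern hp (hYm n) (hYind n) (hY₁ n) (hY₀ n)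
    (f n) (t * n)
  -- Continuity at `t` absorbs the shifts: `t - δ` serves the upper bound, `t + δ` the lower.
  have hnhds : ∀ {r r' : ℝ}, r < L → L < r' → ∃ δ > 0,
      (r : EReal) < φ (t - δ) ∧ φ (t + δ) < (r' : EReal) := by
    intro r r' hr hr'
    have h1 := ht.eventually_const_lt (u := (r : EReal)) (by rw [hL]; exact_mod_cast hr)
    have h2 := ht.eventually_lt_const (u := (r' : EReal)) (by rw [hL]; exact_mod_cast hr')
    obtain ⟨e, he, h⟩ := Metric.eventually_nhds_iff.1 (h1.and h2)
    refine ⟨e / 2, half_pos he, (h ?_).1, (h ?_).2⟩ <;>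
    · rw [Real.dist_eq, abs_lt]; constructor <;> linarith
  have hboth : ∀ η : ℝ, 0 < η → ∀ᶠ n : ℕ in atTop,
      0 < (P n).real {ω | t * n ≤ f n (fun i => Y n i ω)} ∧
      -(L + η) * n ≤ Real.log ((P n).real {ω | t * n ≤ f n (fun i => Y n i ω)}) ∧
      Real.log ((P n).real {ω | t * n ≤ f n (fun i => Y n i ω)}) ≤ (-L + η) * n := by
    intro η hη
    obtain ⟨δ, hδ, hlo, hhi⟩ := hnhds (r := L - η / 2) (r' := L + η / 4) (by linarith)
      (by linarith)
    filter_upwards [NonlinearLD.eventually_log_ge hf ha hb (fun n hn x hx i => hc n hn x hx i i)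
        hc₃ hp hδ hη hL0 ((hφ _).eventually_lt_const hhi),
      NonlinearLD.eventually_log_le (fun n hn => (hf n hn).1) hb hC hp hδ hη
        ((hφ _).eventually_const_lt hlo)] with n h1 h2
    rw [hreal]
    exact ⟨h1.1, h1.2, h2 h1.1⟩
  refine ⟨?_, ?_⟩
  · filter_upwards [hboth 1 one_pos] with n hn
    exact (ENNReal.toReal_pos_iff.1 hn.1).1
  · rw [hL, EReal.toReal_coe, Metric.tendsto_nhds]
    intro ε hε
    filter_upwards [hboth (ε / 2) (half_pos hε), eventually_ge_atTop 1] with n h hn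
    have hn0 : (0 : ℝ) < n := by exact_mod_cast hn
    have h1 := (le_div_iff₀ hn0).2 h.2.1
    have h2 := (div_le_iff₀ hn0).2 h.2.2
    rw [Real.dist_eq, abs_lt]
    constructor <;> linarith
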